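/- Let $n\ge 3$, let $S^{n-1}=\{x\in\mathbb{R}^n:|x|=1\}$ be the unit sphere with its surface measure, and let $f,g:S^{n-1}\to\mathbb{R}$ be integrable ($L^1$) functions. For $u\in S^{n-1}$ let $u^\perp=\{x\in\mathbb{R}^n:\langle x,u\rangle=0\}$, and equip the equator $S^{n-1}\cap u^\perp$, which is the unit sphere of the $(n-1)$-dimensional Euclidean space $u^\perp$, with its own $(n-2)$-dimensional surface measure. Suppose that for almost every $u\in S^{n-1}$ at least one of the following holds: (i) $f(x)=g(x)$ for almost every $x\in S^{n-1}\cap u^\perp$; (ii) $f(x)=g(-x)$ for almost every $x\in S^{n-1}\cap u^\perp$. Then $f(x)=g(x)$ for almost every $x\in S^{n-1}$, or $f(x)=g(-x)$ for almost every $x\in S^{n-1}$. -/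

import Mathlib

open MeasureTheory Metric

noncomputable section

/-- The unit sphere `S^{n-1} = {x ∈ ℝⁿ : |x| = 1}`. -/
abbrev UnitSphere (n : ℕ) : Type := sphere (0 : EuclideanSpace ℝ (Fin n)) 1

/-- The volume element `dx` on `S^{n-1}`: the surface measure induced by Lebesgue measure on `ℝⁿ`,
normalized so that the total mass of `S^{n-1}` is `n` times the volume of the unit ball. -/
def surfaceMeasure (n : ℕ) : Measure (UnitSphere n) :=
  (volume : Measure (EuclideanSpace ℝ (Fin n))).toSphere

/-- The linear hyperplane `u^⊥ = {x ∈ ℝⁿ : ⟨u, x⟩ = 0}`. -/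
abbrev perp {n : ℕ} (u : UnitSphere n) : Submodule ℝ (EuclideanSpace ℝ (Fin n)) :=
  (Submodule.span ℝ {(u : EuclideanSpace ℝ (Fin n))})ᗮ

/-- The equator `S^{n-1} ∩ u^⊥`, as the unit sphere of the Euclidean space `u^⊥`. -/
abbrev Equator {n : ℕ} (u : UnitSphere n) : Type := sphere (0 : perp u) 1

/-- The inclusion of the equator `S^{n-1} ∩ u^⊥` into `S^{n-1}`. -/
def Equator.incl {n : ℕ} (u : UnitSphere n) (x : Equator u) : UnitSphere n :=
  ⟨((x : perp u) : EuclideanSpace ℝ (Fin n)), by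
    have h : ‖(x : perp u)‖ = 1 := norm_eq_of_mem_sphere x
    exact mem_sphere_zero_iff_norm.2 h⟩

/-- The image of the inclusion is `{x ∈ S^{n-1} : ⟨u, x⟩ = 0}`. -/
theorem Equator.range_incl {n : ℕ} (u : UnitSphere n) :
    Set.range (Equator.incl u) =
      {x : UnitSphere n |
        inner ℝ (u : EuclideanSpace ℝ (Fin n)) (x : EuclideanSpace ℝ (Fin n)) = 0} := by
  ext x
  constructor
  · rintro ⟨y, rfl⟩
    exact Submodule.mem_orthogonal_singleton_iff_inner_right.1 (y : perp u).2
  · intro hx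
    have hn : ‖(x : EuclideanSpace ℝ (Fin n))‖ = 1 := norm_eq_of_mem_sphere x
    exact ⟨⟨⟨x, Submodule.mem_orthogonal_singleton_iff_inner_right.2 hx⟩,
      mem_sphere_zero_iff_norm.2 hn⟩, rfl⟩

/-- The volume element on the equator `S^{n-1} ∩ u^⊥`: the surface measure induced by the
Lebesgue measure of the inner product space `u^⊥`. (The instance is written out because `volume`
on `u^⊥` could also be read as the restriction of the Lebesgue measure of `ℝⁿ`, which is zero.) -/
def equatorMeasure {n : ℕ} (u : UnitSphere n) : Measure (Equator u) :=
  (@volume (perp u) measureSpaceOfInnerProductSpace).toSphere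

end

/-! Let D and E be the sets where f(x) ≠ g(x) and f(x) ≠ g(-x). Almost every equator meets D or E in
a null set, and one of them must be shown null. Replace both by their cones and split ℝⁿ as w^⊥ × ℝ:
the hyperplane normal to (b, t), t ≠ 0, is the graph of y ↦ -t⁻¹⟨y, b⟩. Fix a good t. For almost all
b, y, z, the graph points over y and z do not lie in the two cones respectively. For independent y,
z the two heights, as b varies, sweep out ℝ², so the product of the cones is null, hence one cone is
null (`ae_notMem_or_of_ae_graph`). Independence of almost all y, z needs dim w^⊥ ≥ 2, that is n ≥ 3.
-/

/-- The open cone over a subset of the unit sphere. -/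
def sphereCone {E : Type*} [NormedAddCommGroup E] [NormedSpace ℝ E]
    (D : Set (sphere (0 : E) 1)) : Set E :=
  {v | ∃ r : ℝ, 0 < r ∧ ∃ d ∈ D, v = r • (d : E)}

/-! ### Null sets of the sphere and null cones. -/

section Cone

variable {E : Type*} [NormedAddCommGroup E] [NormedSpace ℝ E]

theorem sphereCone_eq_image (D : Set (sphere (0 : E) 1)) :
    sphereCone D =
      (fun p : sphere (0 : E) 1 × Set.Ioi (0 : ℝ) =>
        (((homeomorphUnitSphereProd E).symm p : ({0}ᶜ : Set E)) : E)) '' (D ×ˢ Set.univ) := by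
  ext v
  constructor
  · rintro ⟨r, hr, d, hd, rfl⟩
    exact ⟨(d, ⟨r, hr⟩), ⟨hd, trivial⟩, rfl⟩
  · rintro ⟨⟨d, r⟩, ⟨hd, -⟩, rfl⟩
    exact ⟨r, r.2, d, hd, rfl⟩

variable [MeasurableSpace E] [BorelSpace E]

theorem measurableSet_sphereCone [FiniteDimensional ℝ E] {D : Set (sphere (0 : E) 1)}
    (hD : MeasurableSet D) : MeasurableSet (sphereCone D) := by
  rw [sphereCone_eq_image]
  exact ((MeasurableEmbedding.subtype_coe (measurableSet_singleton _).compl).comp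
    (homeomorphUnitSphereProd E).symm.measurableEmbedding).measurableSet_image.2
      (hD.prod MeasurableSet.univ)

instance volumeIoiPow_ae_neBot (n : ℕ) : (ae (Measure.volumeIoiPow n)).NeBot := by
  rw [ae_neBot]
  intro h
  have h1 := Measure.volumeIoiPow_apply_Iio n ⟨1, Set.mem_Ioi.2 one_pos⟩
  rw [h] at h1
  have h2 : (0 : ℝ) < 1 / (n + 1) := by positivity
  simp only [Measure.coe_zero, Pi.zero_apply, one_pow] at h1
  exact absurd h1.symm (ENNReal.ofReal_pos.2 h2).ne'

/-- Polar coordinates and Fubini. `D` is arbitrary because this is also applied to the set of bad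
normals `u`, whose measurability is not known. -/
theorem ae_toSphere_notMem_iff [FiniteDimensional ℝ E] (μ : Measure E) [μ.IsAddHaarMeasure]
    (D : Set (sphere (0 : E) 1)) :
    (∀ᵐ x ∂μ.toSphere, x ∉ D) ↔ ∀ᵐ v ∂μ, v ∉ sphereCone D := by
  have hmp := μ.measurePreserving_homeomorphUnitSphereProd
  have hemb := MeasurableEmbedding.subtype_coe (measurableSet_singleton (0 : E)).compl
  constructor
  · intro h
    have h1 : ∀ᵐ p ∂(μ.toSphere.prod (Measure.volumeIoiPow (Module.finrank ℝ E - 1))),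
        p.1 ∉ D := Measure.quasiMeasurePreserving_fst.ae h
    have h2 := hmp.quasiMeasurePreserving.ae h1
    have h3 : ∀ᵐ v ∂μ.restrict ({0}ᶜ : Set E), v ∉ sphereCone D := by
      rw [← Subtype.range_coe (s := ({0}ᶜ : Set E)), ← hemb.map_comap, hemb.ae_map_iff]
      filter_upwards [h2] with v hv
      rintro ⟨r, hr, d, hd, hvd⟩
      apply hv
      have : v = (homeomorphUnitSphereProd E).symm (d, ⟨r, hr⟩) := Subtype.ext hvd
      rw [this, Homeomorph.apply_symm_apply]
      exact hd
    rw [ae_restrict_iff' (measurableSet_singleton (0 : E)).compl] at h3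
    filter_upwards [h3] with v hv hvD
    refine hv ?_ hvD
    obtain ⟨r, hr, d, -, rfl⟩ := hvD
    exact smul_ne_zero hr.ne' (ne_zero_of_mem_unit_sphere d)
  · intro h
    have h1 : ∀ᵐ v : ({0}ᶜ : Set E) ∂(μ.comap (↑)), (v : E) ∉ sphereCone D := by
      rw [← hemb.ae_map_iff (p := fun v : E => v ∉ sphereCone D), hemb.map_comap]
      exact ae_restrict_of_ae h
    have hsymm := hmp.symm (homeomorphUnitSphereProd E).toMeasurableEquiv
    have h2 := hsymm.quasiMeasurePreserving.ae h1
    have h3 := Measure.ae_ae_of_ae_prod h2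
    filter_upwards [h3] with x hx hxD
    obtain ⟨r, hr⟩ := hx.exists
    exact hr ⟨r, r.2, x, hxD, rfl⟩

theorem ae_toSphere_neg [FiniteDimensional ℝ E] (μ : Measure E) [μ.IsAddHaarMeasure]
    {p : sphere (0 : E) 1 → Prop} (h : ∀ᵐ x ∂μ.toSphere, p x) : ∀ᵐ x ∂μ.toSphere, p (-x) := by
  have h1 := (ae_toSphere_notMem_iff μ {x | ¬ p x}).1 (by simpa using h)
  have h2 := (Measure.measurePreserving_neg μ).quasiMeasurePreserving.ae h1
  have h3 := (ae_toSphere_notMem_iff μ {x | ¬ p (-x)}).2 (by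
    filter_upwards [h2] with v hv
    rintro ⟨r, hr, d, hd, rfl⟩
    exact hv ⟨r, hr, -d, hd, by simp⟩)
  simpa using h3

end Cone

/-! ### Fubini argument for linear graphs. -/

section Graph

variable {W : Type*} [NormedAddCommGroup W] [InnerProductSpace ℝ W]

/-- The pairing of a vector with two given vectors, scaled by a real number. -/
noncomputable def innerPair (c : ℝ) (y z : W) : W →ₗ[ℝ] ℝ × ℝ :=
  c • ((innerₛₗ ℝ y).prod (innerₛₗ ℝ z))

theorem innerPair_apply (c : ℝ) (y z b : W) :
    innerPair c y z b = (c * inner ℝ y b, c * inner ℝ z b) := rfl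

theorem innerPair_surjective {c : ℝ} (hc : c ≠ 0) {y z : W} (hy : y ≠ 0)
    (hz : z ∉ Submodule.span ℝ {y}) : Function.Surjective (innerPair c y z) := by
  have hyy : (inner ℝ y y : ℝ) ≠ 0 := inner_self_ne_zero.2 hy
  set k : ℝ := inner ℝ y z / inner ℝ y y with hk
  set z' : W := z - k • y with hz'
  have hz0 : z' ≠ 0 := fun h0 =>
    hz (Submodule.mem_span_singleton.2 ⟨k, (sub_eq_zero.1 h0).symm⟩)
  have hyz' : (inner ℝ y z' : ℝ) = 0 := by
    rw [hz', inner_sub_right, inner_smul_right, hk]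
    field_simp
    ring
  have hzz' : (inner ℝ z z' : ℝ) = inner ℝ z' z' := by
    have : z = z' + k • y := by rw [hz']; abel
    conv_lhs => rw [this]
    rw [inner_add_left, inner_smul_left, hyz']
    simp
  have hz'z' : (inner ℝ z' z' : ℝ) ≠ 0 := inner_self_ne_zero.2 hz0
  rintro ⟨s, t⟩
  refine ⟨(s / c / inner ℝ y y) • y +
    ((t / c - s / c / inner ℝ y y * inner ℝ z y) / inner ℝ z' z') • z', ?_⟩
  rw [innerPair_apply]
  simp only [inner_add_right, inner_smul_right, hyz', hzz']
  ext
  · field_simp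
    ring
  · field_simp
    ring

variable [FiniteDimensional ℝ W] [MeasurableSpace W] [BorelSpace W]
  (ν : Measure W) [ν.IsAddHaarMeasure]

/-- Two sets such that almost every linear graph meets one of them in a null set cannot both have
positive measure. -/
theorem ae_notMem_or_of_ae_graph (hdim : 2 ≤ Module.finrank ℝ W) {c : ℝ} (hc : c ≠ 0)
    {A B : Set (W × ℝ)} (hA : MeasurableSet A) (hB : MeasurableSet B)
    (h : ∀ᵐ b ∂ν, (∀ᵐ y ∂ν, (y, c * inner ℝ y b) ∉ A) ∨ (∀ᵐ z ∂ν, (z, c * inner ℝ z b) ∉ B)) :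
    (∀ᵐ p ∂ν.prod volume, p ∉ A) ∨ (∀ᵐ p ∂ν.prod volume, p ∉ B) := by
  have hbyz : ∀ᵐ b ∂ν, ∀ᵐ q ∂ν.prod ν,
      ¬ ((q.1, c * inner ℝ q.1 b) ∈ A ∧ (q.2, c * inner ℝ q.2 b) ∈ B) := by
    filter_upwards [h] with b hb
    rcases hb with hb | hb
    · filter_upwards [Measure.quasiMeasurePreserving_fst.ae hb] with q hq h2 using hq h2.1
    · filter_upwards [Measure.quasiMeasurePreserving_snd.ae hb] with q hq h2 using hq h2.2
  have hmeas : MeasurableSet {x : W × (W × W) |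
      ¬ ((x.2.1, c * inner ℝ x.2.1 x.1) ∈ A ∧ (x.2.2, c * inner ℝ x.2.2 x.1) ∈ B)} := by
    have m1 : Measurable fun x : W × (W × W) => (x.2.1, c * inner ℝ x.2.1 x.1) := by fun_prop
    have m2 : Measurable fun x : W × (W × W) => (x.2.2, c * inner ℝ x.2.2 x.1) := by fun_prop
    exact ((m1 hA).inter (m2 hB)).compl
  -- The key exchange: fix the base points y, z and let the slope b vary.
  rw [Measure.ae_ae_comm hmeas] at hbyz
  have hyz := Measure.ae_ae_of_ae_prod hbyz
  have : Nontrivial W := Module.nontrivial_of_finrank_pos (R := ℝ) (by omega)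
  have hy0 : ∀ᵐ y ∂ν, y ≠ 0 := Measure.ae_ne ν 0
  have hst : ∀ᵐ y ∂ν, ∀ᵐ z ∂ν, ∀ᵐ s : ℝ, ∀ᵐ t : ℝ, ¬ ((y, s) ∈ A ∧ (z, t) ∈ B) := by
    filter_upwards [hyz, hy0] with y hy hy0
    have hspan : ∀ᵐ z ∂ν, z ∉ Submodule.span ℝ {y} := by
      refine measure_eq_zero_iff_ae_notMem.1 (Measure.addHaar_submodule ν _ fun htop => ?_)
      have h1 := finrank_span_singleton (K := ℝ) hy0
      rw [htop, finrank_top] at h1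
      omega
    filter_upwards [hy, hspan] with z hz hzs
    have hS : MeasurableSet {q : ℝ × ℝ | ¬ ((y, q.1) ∈ A ∧ (z, q.2) ∈ B)} := by
      have m1 : Measurable fun q : ℝ × ℝ => (y, q.1) := by fun_prop
      have m2 : Measurable fun q : ℝ × ℝ => (z, q.2) := by fun_prop
      exact ((m1 hA).inter (m2 hB)).compl
    have := (ae_comp_linearMap_mem_iff (innerPair c y z) ν (volume.prod volume)
      (innerPair_surjective hc hy0 hzs) hS).1 hz
    exact Measure.ae_ae_of_ae_prod this
  rw [Measure.ae_prod_iff_ae_ae hA.compl, Measure.ae_prod_iff_ae_ae hB.compl]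
  by_contra hcon
  rw [not_or] at hcon
  refine hcon.1 ?_
  filter_upwards [hst] with y hy
  -- If the slice of `A` over one such y is not null, some height s in it forces almost every slice
  -- of `B` to be null.
  by_contra hys
  refine hcon.2 ?_
  filter_upwards [hy] with z hz
  obtain ⟨s, hs, hzs⟩ := ((Filter.not_eventually.1 hys).and_eventually hz).exists
  filter_upwards [hzs] with t ht hB' using ht ⟨not_not.1 hs, hB'⟩

end Graph

/-! ### Hyperplanes as graphs over a fixed hyperplane. -/

section Hyperplane

theorem ae_comp_linearMap_of_surjective {E F : Type*} [NormedAddCommGroup E] [NormedSpace ℝ E]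
    [FiniteDimensional ℝ E] [MeasurableSpace E] [BorelSpace E] [NormedAddCommGroup F]
    [NormedSpace ℝ F] [MeasurableSpace F] [BorelSpace F] (L : E →ₗ[ℝ] F) (μ : Measure E)
    (ν : Measure F) [μ.IsAddHaarMeasure] [ν.IsAddHaarMeasure] (hL : Function.Surjective L)
    {p : F → Prop} (h : ∀ᵐ y ∂ν, p y) : ∀ᵐ x ∂μ, p (L x) := by
  obtain ⟨c, -, hc⟩ := L.exists_map_addHaar_eq_smul_addHaar μ ν hL
  refine ae_of_ae_map L.continuous_of_finiteDimensional.aemeasurable ?_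
  rw [hc]
  exact Measure.smul_absolutelyContinuous.ae_le h

variable {n : ℕ}

theorem mem_sphereCone_preimage_incl {u : UnitSphere n} {D : Set (UnitSphere n)} {x : perp u}
    (hx : (x : EuclideanSpace ℝ (Fin n)) ∈ sphereCone D) :
    x ∈ sphereCone (Equator.incl u ⁻¹' D) := by
  obtain ⟨r, hr, d, hd, hxd⟩ := hx
  have hmem : (d : EuclideanSpace ℝ (Fin n)) ∈ perp u := by
    have h1 := (perp u).smul_mem r⁻¹ x.2
    rwa [hxd, inv_smul_smul₀ hr.ne'] at h1
  exact ⟨r, hr, ⟨⟨d, hmem⟩, mem_sphere_zero_iff_norm.2 (norm_eq_of_mem_sphere d)⟩, hd,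
    Subtype.ext hxd⟩

theorem ae_equator_imp_ae_perp {u : UnitSphere n} {D : Set (UnitSphere n)}
    (h : ∀ᵐ x ∂equatorMeasure u, Equator.incl u x ∉ D) :
    ∀ᵐ x : perp u ∂(@volume (perp u) measureSpaceOfInnerProductSpace),
      (x : EuclideanSpace ℝ (Fin n)) ∉ sphereCone D := by
  filter_upwards [(ae_toSphere_notMem_iff (@volume (perp u) measureSpaceOfInnerProductSpace)
    (Equator.incl u ⁻¹' D)).1 h] with x hx hxD
  exact hx (mem_sphereCone_preimage_incl hxD)

/-- The decomposition of space along a hyperplane and its normal. -/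
noncomputable def perpSplit (w : UnitSphere n) : perp w × ℝ →ₗ[ℝ] EuclideanSpace ℝ (Fin n) :=
  (perp w).subtype.coprod (LinearMap.toSpanSingleton ℝ _ (w : EuclideanSpace ℝ (Fin n)))

theorem perpSplit_apply (w : UnitSphere n) (p : perp w × ℝ) :
    perpSplit w p = (p.1 : EuclideanSpace ℝ (Fin n)) + p.2 • (w : EuclideanSpace ℝ (Fin n)) := rfl

theorem inner_coe_perp (w : UnitSphere n) (b : perp w) :
    inner ℝ (w : EuclideanSpace ℝ (Fin n)) (b : EuclideanSpace ℝ (Fin n)) = 0 :=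
  Submodule.mem_orthogonal_singleton_iff_inner_right.1 b.2

theorem inner_self_unitSphere (w : UnitSphere n) :
    inner ℝ (w : EuclideanSpace ℝ (Fin n)) (w : EuclideanSpace ℝ (Fin n)) = 1 := by
  rw [real_inner_self_eq_norm_sq, norm_eq_of_mem_sphere w, one_pow]

theorem perpSplit_surjective (w : UnitSphere n) : Function.Surjective (perpSplit w) := by
  intro x
  refine ⟨(⟨x - (inner ℝ (w : EuclideanSpace ℝ (Fin n)) x : ℝ) • (w : EuclideanSpace ℝ (Fin n)),
    ?_⟩, inner ℝ (w : EuclideanSpace ℝ (Fin n)) x), ?_⟩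
  · rw [Submodule.mem_orthogonal_singleton_iff_inner_right, inner_sub_right, inner_smul_right,
      inner_self_unitSphere]
    ring
  · rw [perpSplit_apply]
    exact sub_add_cancel _ _

/-- The scalar product in the coordinates of `perpSplit`. -/
theorem inner_perpSplit (w : UnitSphere n) (p q : perp w × ℝ) :
    inner ℝ (perpSplit w p) (perpSplit w q) = inner ℝ p.1 q.1 + p.2 * q.2 := by
  have h1 := inner_coe_perp w p.1
  rw [real_inner_comm] at h1
  simp only [perpSplit_apply, inner_add_left, inner_add_right, inner_smul_left, inner_smul_right,
    inner_coe_perp, inner_self_unitSphere, h1, Submodule.coe_inner]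
  simp
  ring

/-- If almost every point of `u^⊥` avoids a cone, then so does almost every point of the same
hyperplane, parametrised as a graph over `w^⊥`. -/
theorem ae_graph_notMem_sphereCone {w u : UnitSphere n} {ν : Measure (perp w)}
    [ν.IsAddHaarMeasure] {b : perp w} {t r : ℝ} (ht : t ≠ 0) (hr : r ≠ 0)
    (hu : perpSplit w (b, t) = r • (u : EuclideanSpace ℝ (Fin n))) {D : Set (UnitSphere n)}
    (h : ∀ᵐ x ∂equatorMeasure u, Equator.incl u x ∉ D) :
    ∀ᵐ y ∂ν, perpSplit w (y, -t⁻¹ * inner ℝ y b) ∉ sphereCone D := by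
  have hinner (q : perp w × ℝ) : perpSplit w q ∈ perp u ↔ inner ℝ b q.1 + t * q.2 = 0 := by
    rw [Submodule.mem_orthogonal_singleton_iff_inner_right, ← inner_perpSplit w (b, t) q, hu,
      real_inner_smul_left]
    simp [hr]
  let G : perp w →ₗ[ℝ] perp u :=
    ((perpSplit w) ∘ₗ (LinearMap.id.prod (-t⁻¹ • (innerₛₗ ℝ b)))).codRestrict (perp u) (by
      intro y
      change perpSplit w (y, -t⁻¹ * inner ℝ b y) ∈ perp u
      rw [hinner]
      field_simp
      ring)
  have hGapp (y : perp w) : (G y : EuclideanSpace ℝ (Fin n)) =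
      perpSplit w (y, -t⁻¹ * inner ℝ b y) := rfl
  have hG : Function.Surjective G := by
    rintro ⟨x, hx⟩
    obtain ⟨⟨y, s⟩, rfl⟩ := perpSplit_surjective w x
    refine ⟨y, Subtype.ext ?_⟩
    rw [hinner] at hx
    rw [hGapp]
    have : -t⁻¹ * inner ℝ b y = s := by
      rw [eq_neg_of_add_eq_zero_left hx]
      field_simp
    rw [this]
  filter_upwards [ae_comp_linearMap_of_surjective G ν
    (@volume (perp u) measureSpaceOfInnerProductSpace) hG (ae_equator_imp_ae_perp h)] with y hy
  rw [hGapp, real_inner_comm] at hy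
  exact hy

theorem ae_notMem_or_of_ae_equator (hn : 3 ≤ n) {D E : Set (UnitSphere n)}
    (hD : MeasurableSet D) (hE : MeasurableSet E)
    (h : ∀ᵐ u ∂surfaceMeasure n, (∀ᵐ x ∂equatorMeasure u, Equator.incl u x ∉ D) ∨
      (∀ᵐ x ∂equatorMeasure u, Equator.incl u x ∉ E)) :
    (∀ᵐ x ∂surfaceMeasure n, x ∉ D) ∨ (∀ᵐ x ∂surfaceMeasure n, x ∉ E) := by
  let w : UnitSphere n := ⟨EuclideanSpace.single ⟨0, by omega⟩ 1, by simp⟩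
  let ν : Measure (perp w) := @volume (perp w) measureSpaceOfInnerProductSpace
  have hdim : 2 ≤ Module.finrank ℝ (perp w) := by
    have h1 := (Submodule.span ℝ {(w : EuclideanSpace ℝ (Fin n))}).finrank_add_finrank_orthogonal
    rw [finrank_span_singleton (ne_zero_of_mem_unit_sphere w), finrank_euclideanSpace_fin] at h1
    change 1 + Module.finrank ℝ (perp w) = n at h1
    omega
  have hv := (ae_toSphere_notMem_iff volume {u : UnitSphere n |
    ¬ ((∀ᵐ x ∂equatorMeasure u, Equator.incl u x ∉ D) ∨
      (∀ᵐ x ∂equatorMeasure u, Equator.incl u x ∉ E))}).1 (by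
        filter_upwards [h] with u hu using not_not.2 hu)
  have hprod := ae_comp_linearMap_of_surjective (perpSplit w) (ν.prod volume) volume
    (perpSplit_surjective w) hv
  have hswap := Measure.ae_ae_of_ae_prod
    ((Measure.measurePreserving_swap (μ := volume) (ν := ν)).quasiMeasurePreserving.ae hprod)
  -- One height t suffices: the normals (b, t) already give all non-vertical hyperplanes.
  obtain ⟨t, hb, ht⟩ := (hswap.and (Measure.ae_ne (volume : Measure ℝ) 0)).exists
  have hmeas : Measurable (perpSplit w) :=
    (perpSplit w).continuous_of_finiteDimensional.measurable
  have key := ae_notMem_or_of_ae_graph ν hdim (neg_ne_zero.2 (inv_ne_zero ht))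
    (hmeas (measurableSet_sphereCone hD)) (hmeas (measurableSet_sphereCone hE)) (by
      filter_upwards [hb] with b hb
      have hne : perpSplit w (b, t) ≠ 0 := by
        intro h0
        have h1 := inner_perpSplit w (b, t) (0, t)
        rw [h0, inner_zero_left, inner_zero_right, zero_add] at h1
        exact mul_self_ne_zero.2 ht h1.symm
      let u : UnitSphere n := ⟨‖perpSplit w (b, t)‖⁻¹ • perpSplit w (b, t), by
        rw [mem_sphere_zero_iff_norm, norm_smul, norm_inv, norm_norm,
          inv_mul_cancel₀ (norm_ne_zero_iff.2 hne)]⟩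
      have hu : perpSplit w (b, t) =
          ‖perpSplit w (b, t)‖ • (u : EuclideanSpace ℝ (Fin n)) :=
        (smul_inv_smul₀ (norm_ne_zero_iff.2 hne) _).symm
      have hgood : (∀ᵐ x ∂equatorMeasure u, Equator.incl u x ∉ D) ∨
          (∀ᵐ x ∂equatorMeasure u, Equator.incl u x ∉ E) := by
        by_contra hbad
        exact hb ⟨_, norm_pos_iff.2 hne, u, hbad, hu⟩
      exact hgood.imp (ae_graph_notMem_sphereCone ht (norm_ne_zero_iff.2 hne) hu)
        (ae_graph_notMem_sphereCone ht (norm_ne_zero_iff.2 hne) hu))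
  refine key.imp (fun hk => ?_) (fun hk => ?_)
  · exact (ae_toSphere_notMem_iff volume D).2 ((ae_comp_linearMap_mem_iff (perpSplit w)
      (ν.prod volume) volume (perpSplit_surjective w) (measurableSet_sphereCone hD).compl).1 hk)
  · exact (ae_toSphere_notMem_iff volume E).2 ((ae_comp_linearMap_mem_iff (perpSplit w)
      (ν.prod volume) volume (perpSplit_surjective w) (measurableSet_sphereCone hE).compl).1 hk)

end Hyperplane

/-! ### Application to the disagreement sets. -/

theorem mainTheorem8 (n : ℕ) (hn : 3 ≤ n) (f g : UnitSphere n → ℝ)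
    (hf : Integrable f (surfaceMeasure n)) (hg : Integrable g (surfaceMeasure n))
    (h : ∀ᵐ u ∂(surfaceMeasure n),
      (∀ᵐ x ∂(equatorMeasure u), f (Equator.incl u x) = g (Equator.incl u x)) ∨
      (∀ᵐ x ∂(equatorMeasure u), f (Equator.incl u x) = g (-Equator.incl u x))) :
    (∀ᵐ x ∂(surfaceMeasure n), f x = g x) ∨ (∀ᵐ x ∂(surfaceMeasure n), f x = g (-x)) := by
  have hneg : Measure.QuasiMeasurePreserving (fun x : UnitSphere n => -x)
      (surfaceMeasure n) (surfaceMeasure n) := by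
    refine ⟨continuous_neg.measurable, Measure.AbsolutelyContinuous.mk fun s hs h0 => ?_⟩
    rw [Measure.map_apply continuous_neg.measurable hs]
    exact measure_eq_zero_iff_ae_notMem.2
      (ae_toSphere_neg volume (measure_eq_zero_iff_ae_notMem.1 h0))
  have hD : NullMeasurableSet {x | f x ≠ g x} (surfaceMeasure n) :=
    (nullMeasurableSet_eq_fun hf.aemeasurable hg.aemeasurable).compl
  have hE : NullMeasurableSet {x | f x ≠ g (-x)} (surfaceMeasure n) :=
    (nullMeasurableSet_eq_fun hf.aemeasurable
      (hg.aemeasurable.comp_quasiMeasurePreserving hneg)).compl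
  -- A null change on the sphere may be visible on an equator, so the measurable versions are taken
  -- as subsets, which inherit the hypothesis.
  obtain ⟨D, hDsub, hDm, hDae⟩ := hD.exists_measurable_subset_ae_eq
  obtain ⟨E, hEsub, hEm, hEae⟩ := hE.exists_measurable_subset_ae_eq
  refine (ae_notMem_or_of_ae_equator hn hDm hEm ?_).imp (fun hk => ?_) (fun hk => ?_)
  · filter_upwards [h] with u hu
    refine hu.imp (fun hx => ?_) (fun hx => ?_)
    · filter_upwards [hx] with x hx hxD using hDsub hxD hx
    · filter_upwards [hx] with x hx hxE using hEsub hxE hx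
  · filter_upwards [hk, hDae.mem_iff] with x hx hiff
    by_contra hne
    exact hx (hiff.2 hne)
  · filter_upwards [hk, hEae.mem_iff] with x hx hiff
    by_contra hne
    exact hx (hiff.2 hne)
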